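/- Let $(N,g_N)$ be a complete simply connected smooth Riemannian manifold of dimension $d\ge 1$, and let $c:\mathbb R\to\mathbb R$ be a smooth function. Let $\Gamma$ be a group acting co-compactly and totally discontinuously by isometries on the Riemannian manifold $(\mathbb R^2\times N,\ ds^2+dt^2+e^{2c(t)}g_N)$, where $(s,t)$ are the standard coordinates of $\mathbb R^2$. Here co-compact means that the quotient $\Gamma\backslash(\mathbb R^2\times N)$ is compact, and totally discontinuous means that every point of $\mathbb R^2\times N$ has a neighbourhood $U$ such that $\gamma U\cap U\neq\emptyset$ for only finitely many $\gamma\in\Gamma$. Assume moreover that $\Gamma$ preserves the vector fields $\partial_s$ and $\partial_t$. Then $c$, regarded as the function $(s,t,x)\mapsto c(t)$ on $\mathbb R^2\times N$, is $\Gamma$-invariant: for all $\gamma\in\Gamma$ and all $(s,t,x)\in\mathbb R^2\times N$, if $\gamma(s,t,x)=(s',t',x')$, then $c(t')=c(t)$. -/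

import Mathlib

open Set Filter Topology Bundle
open scoped Manifold ContDiff Bundle

noncomputable section

namespace WarpedPlane

/-- The model with corners of the product manifold `ℝ × ℝ × N`, where `N` has dimension `d`. -/
abbrev model (d : ℕ) := 𝓘(ℝ, ℝ).prod (𝓘(ℝ, ℝ).prod (𝓡 d))

section

variable {d : ℕ} {N : Type*} [TopologicalSpace N] [ChartedSpace (EuclideanSpace ℝ (Fin d)) N]

/-- The value `ds(v)` of the coordinate one-form `ds` on `ℝ × ℝ × N`, whose points are `(s, t, x)`.
The tangent space at `(s, t, x)` is `ℝ × ℝ × T_x N`. -/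
def ds (p : ℝ × ℝ × N) (v : TangentSpace (model d) p) : ℝ :=
  (show ℝ × ℝ × EuclideanSpace ℝ (Fin d) from v).1

/-- The value `dt(v)` of the coordinate one-form `dt` on `ℝ × ℝ × N`. -/
def dt (p : ℝ × ℝ × N) (v : TangentSpace (model d) p) : ℝ :=
  (show ℝ × ℝ × EuclideanSpace ℝ (Fin d) from v).2.1

/-- The component in `T_x N` of a vector tangent to `ℝ × ℝ × N` at `(s, t, x)`. -/
def tangentN (p : ℝ × ℝ × N) (v : TangentSpace (model d) p) : TangentSpace (𝓡 d) p.2.2 :=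
  (show ℝ × ℝ × EuclideanSpace ℝ (Fin d) from v).2.2

/-- The coordinate vector field `∂_s` on `ℝ × ℝ × N`. -/
def partialS (p : ℝ × ℝ × N) : TangentSpace (model d) p :=
  show ℝ × ℝ × EuclideanSpace ℝ (Fin d) from (1, 0, 0)

/-- The coordinate vector field `∂_t` on `ℝ × ℝ × N`. -/
def partialT (p : ℝ × ℝ × N) : TangentSpace (model d) p :=
  show ℝ × ℝ × EuclideanSpace ℝ (Fin d) from (0, 1, 0)

/-- The Riemannian metric `ds² + dt² + e^{2c(t)} g_N` on `ℝ × ℝ × N`, where `g_N` is the Riemannian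
metric that `N` carries. -/
def metric [RiemannianBundle (fun x : N ↦ TangentSpace (𝓡 d) x)] (c : ℝ → ℝ)
    (p : ℝ × ℝ × N) (v w : TangentSpace (model d) p) : ℝ :=
  ds p v * ds p w + dt p v * dt p w
    + Real.exp (2 * c p.2.1) * inner ℝ (tangentN p v) (tangentN p w)

/-- `Γ` acts on `ℝ × ℝ × N` by smooth isometries of `ds² + dt² + e^{2c(t)} g_N`. (Each map is a
diffeomorphism, as its inverse is the smooth map given by the inverse group element.) -/
def ActsByIsometries (d : ℕ) (Γ N : Type*) [TopologicalSpace N]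
    [ChartedSpace (EuclideanSpace ℝ (Fin d)) N]
    [RiemannianBundle (fun x : N ↦ TangentSpace (𝓡 d) x)]
    [Group Γ] [MulAction Γ (ℝ × ℝ × N)] (c : ℝ → ℝ) : Prop :=
  ∀ γ : Γ, ContMDiff (model d) (model d) ∞ (fun p : ℝ × ℝ × N ↦ γ • p) ∧
    ∀ (p : ℝ × ℝ × N) (v w : TangentSpace (model d) p),
      metric c (γ • p)
        (mfderiv (model d) (model d) (fun q : ℝ × ℝ × N ↦ γ • q) p v)
        (mfderiv (model d) (model d) (fun q : ℝ × ℝ × N ↦ γ • q) p w) = metric c p v w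

/-- The action of `Γ` preserves the vector field `V`: the differential of every `γ` maps `V p` to
`V (γ p)`. -/
def PreservesField {d : ℕ} (Γ : Type*) {N : Type*} [TopologicalSpace N]
    [ChartedSpace (EuclideanSpace ℝ (Fin d)) N] [Group Γ] [MulAction Γ (ℝ × ℝ × N)]
    (V : (p : ℝ × ℝ × N) → TangentSpace (model d) p) : Prop :=
  ∀ (γ : Γ) (p : ℝ × ℝ × N),
    mfderiv (model d) (model d) (fun q : ℝ × ℝ × N ↦ γ • q) p (V p) = V (γ • p)

end

/-- `Γ` acts totally discontinuously on `X`: every point has a neighbourhood `U` such that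
`γ U` meets `U` for only finitely many `γ`. The action need not be free. -/
def TotallyDiscontinuous (Γ X : Type*) [TopologicalSpace X] [Group Γ] [MulAction Γ X] : Prop :=
  ∀ x : X, ∃ U ∈ 𝓝 x, {γ : Γ | (((fun y : X ↦ γ • y) '' U) ∩ U).Nonempty}.Finite

/-- `Γ` acts co-compactly on `X`: the quotient space `Γ \ X` is compact. -/
def Cocompact (Γ X : Type*) [TopologicalSpace X] [Group Γ] [MulAction Γ X] : Prop :=
  CompactSpace (MulAction.orbitRel.Quotient Γ X)

end WarpedPlane

end

/-! ### Lipschitz estimates for Riemannian distances, and Hausdorff measure. -/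

section

open Manifold MeasureTheory Measure
open scoped ENNReal NNReal

/-! The forms `ds` and `dt` are metrically dual to `∂_s` and `∂_t`, so `Γ` preserves them as well.
Hence `γ` translates `s` and `t` by constants `a γ`, `b γ`, and acts on `N` by a map `φ γ`
independent of `s` and `t`. The isometry condition says that `φ γ` scales `g_N`-lengths by `e^{c(t)
- c(t + b γ)}`; this cannot depend on `t`, so `c(t + b γ) = c(t) + ℓ γ` and `φ γ` is a similarity of
ratio `e^{-ℓ γ}` (`exists_isSplitAction`). It remains to show that the homomorphism `ℓ : Γ → ℝ`
vanishes.

The reason is finite volume. Let `ν` be the product of Lebesgue measure on the plane and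
`d`-dimensional Hausdorff measure on `N`. The density `e^{dc} ν` is `Γ`-invariant. The translation
of `t` by `b σ` commutes with `Γ` and multiplies this density by a power of `e^{d ℓ σ}`, yet it acts
on a compact quotient, whose volume it cannot change. Since the action need not be free, the proof
replaces the quotient volume by a covering count: translates of a shifted compact set cover the
original one with multiplicity at most `n`, which bounds `ℓ` below (`exists_le_shift`). A
homomorphism to `ℝ` bounded below is zero (`shift_eq_zero`).

The measure must be finite on compact sets and positive on open sets, which holds because charts are
locally bi-Lipschitz. -/

theorem ENNReal.le_coe_mul_of_forall_gt {a b : ℝ≥0∞} {C : ℝ≥0} (hb : b ≠ ⊤)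
    (h : ∀ r, b < r → a ≤ C * r) : a ≤ C * b := by
  have hne : (𝓝[>] b).NeBot := nhdsGT_neBot_of_exists_gt ⟨⊤, hb.lt_top⟩
  have ht : Tendsto (fun r : ℝ≥0∞ ↦ (C : ℝ≥0∞) * r) (𝓝[>] b) (𝓝 (C * b)) :=
    ((ENNReal.continuous_const_mul ENNReal.coe_ne_top).tendsto b).mono_left nhdsWithin_le_nhds
  exact ge_of_tendsto ht (eventually_nhdsWithin_of_forall h)

namespace Manifold

section Lipschitz

variable {E : Type*} [NormedAddCommGroup E] [NormedSpace ℝ E]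
  {H : Type*} [TopologicalSpace H] {I : ModelWithCorners ℝ E H}
  {M : Type*} [TopologicalSpace M] [ChartedSpace H M]
  {E' : Type*} [NormedAddCommGroup E'] [NormedSpace ℝ E']
  {H' : Type*} [TopologicalSpace H'] {I' : ModelWithCorners ℝ E' H'}
  {M' : Type*} [TopologicalSpace M'] [ChartedSpace H' M']

/-- A `C^1` map whose differential is bounded by `C` multiplies lengths of paths by at most `C`. -/
theorem pathELength_comp_le [∀ x : M, ENorm (TangentSpace I x)]
    [∀ x : M', ENorm (TangentSpace I' x)] {f : M → M'} {s : Set M} (hs : IsOpen s)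
    (hf : ContMDiffOn I I' 1 f s) {C : ℝ≥0}
    (hC : ∀ y ∈ s, ∀ v : TangentSpace I y, ‖mfderiv I I' f y v‖ₑ ≤ C * ‖v‖ₑ)
    {η : ℝ → M} (hη : ContMDiffOn 𝓘(ℝ, ℝ) I 1 η (Icc 0 1)) (hηs : MapsTo η (Icc 0 1) s) :
    pathELength I' (f ∘ η) 0 1 ≤ C * pathELength I η 0 1 := by
  rw [pathELength_eq_lintegral_mfderivWithin_Icc, pathELength_eq_lintegral_mfderivWithin_Icc,
    ← lintegral_const_mul' _ _ ENNReal.coe_ne_top]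
  refine setLIntegral_mono' measurableSet_Icc fun t ht ↦ ?_
  have h : mfderiv[Icc 0 1] (f ∘ η) t =
      (mfderiv I I' f (η t)) ∘L (mfderiv[Icc 0 1] η t) := by
    apply mfderiv_comp_mfderivWithin
    · exact ((hf _ (hηs ht)).contMDiffAt (hs.mem_nhds (hηs ht))).mdifferentiableAt one_ne_zero
    · exact hη.mdifferentiableOn one_ne_zero t ht
    · rw [uniqueMDiffWithinAt_iff_uniqueDiffWithinAt]
      exact uniqueDiffOn_Icc zero_lt_one t ht
  have h1 : mfderiv[Icc 0 1] (f ∘ η) t 1 =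
      (mfderiv I I' f (η t)) (mfderiv[Icc 0 1] η t 1) := congr($h 1)
  rw [h1]
  exact hC _ (hηs ht) _

/-- A `C^1` map whose differential is bounded by `C` is `C`-Lipschitz for Riemannian distances. -/
theorem edist_le_of_enorm_mfderiv_le {M : Type*} [PseudoEMetricSpace M] [ChartedSpace H M]
    [RiemannianBundle (fun x : M ↦ TangentSpace I x)] [IsRiemannianManifold I M]
    {M' : Type*} [PseudoEMetricSpace M'] [ChartedSpace H' M']
    [RiemannianBundle (fun x : M' ↦ TangentSpace I' x)] [IsRiemannianManifold I' M']
    {f : M → M'} (hf : ContMDiff I I' 1 f) {C : ℝ≥0}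
    (hC : ∀ y, ∀ v : TangentSpace I y, ‖mfderiv I I' f y v‖ₑ ≤ C * ‖v‖ₑ) {x y : M}
    (hxy : edist x y ≠ ⊤) :
    edist (f x) (f y) ≤ C * edist x y := by
  refine ENNReal.le_coe_mul_of_forall_gt hxy fun r hr ↦ ?_
  rw [IsRiemannianManifold.out (I := I) x y] at hr
  rw [IsRiemannianManifold.out (I := I') (f x) (f y)]
  obtain ⟨η, h0, h1, hη, hlen⟩ := exists_lt_of_riemannianEDist_lt hr
  have hp := pathELength_comp_le isOpen_univ hf.contMDiffOn (fun y _ v ↦ hC y v) hη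
    (mapsTo_univ _ _)
  calc riemannianEDist I' (f x) (f y) ≤ pathELength I' (f ∘ η) 0 1 :=
        riemannianEDist_le_pathELength (hf.comp_contMDiffOn hη) (by simp [h0]) (by simp [h1])
          zero_le_one
    _ ≤ C * pathELength I η 0 1 := hp
    _ ≤ C * r := by gcongr

end Lipschitz

/-! ### Charts are locally bi-Lipschitz; Hausdorff measure of the manifold. -/

section Charts

variable {E : Type*} [NormedAddCommGroup E] [InnerProductSpace ℝ E]
  {M : Type*} [EMetricSpace M] [ChartedSpace E M]
  [RiemannianBundle (fun x : M ↦ TangentSpace 𝓘(ℝ, E) x)] [IsManifold 𝓘(ℝ, E) 1 M]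
  [IsContinuousRiemannianBundle E (fun x : M ↦ TangentSpace 𝓘(ℝ, E) x)]
  [IsRiemannianManifold 𝓘(ℝ, E) M]

attribute [local instance] normedAddCommGroupTangentSpaceVectorSpace
attribute [local instance] normedSpaceTangentSpaceVectorSpace

-- The norm on the target is that of `E` itself, as the operator norm bound requires;
-- `enorm_tangentSpace_vectorSpace` later converts it to the Riemannian norm used by path lengths.
omit [IsRiemannianManifold 𝓘(ℝ, E) M] in
theorem eventually_enorm_mfderiv_extChartAt_apply_le (x : M) :
    ∃ C : ℝ≥0, ∀ᶠ y in 𝓝 x, ∀ v : TangentSpace 𝓘(ℝ, E) y,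
      @enorm E _ (mfderiv 𝓘(ℝ, E) 𝓘(ℝ, E) (extChartAt 𝓘(ℝ, E) x) y v) ≤ C * ‖v‖ₑ := by
  obtain ⟨C, -, hC⟩ := eventually_enorm_mfderiv_extChartAt_lt 𝓘(ℝ, E) x
  refine ⟨C, hC.mono fun y hy v ↦ ?_⟩
  refine (ContinuousLinearMap.le_opENorm (mfderiv 𝓘(ℝ, E) 𝓘(ℝ, E) (extChartAt 𝓘(ℝ, E) x) y)
    v).trans ?_
  gcongr
  exact hy.le

omit [IsRiemannianManifold 𝓘(ℝ, E) M] in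
theorem eventually_enorm_mfderiv_extChartAt_symm_apply_le (x : M) :
    ∃ C : ℝ≥0, ∀ᶠ y in 𝓝 (extChartAt 𝓘(ℝ, E) x x), ∀ v : E,
      ‖mfderiv 𝓘(ℝ, E) 𝓘(ℝ, E) (extChartAt 𝓘(ℝ, E) x).symm y v‖ₑ ≤ C * ‖v‖ₑ := by
  obtain ⟨C, -, hC⟩ := eventually_enorm_mfderivWithin_symm_extChartAt_lt 𝓘(ℝ, E) x
  simp only [modelWithCornersSelf_coe, range_id, nhdsWithin_univ, mfderivWithin_univ] at hC
  refine ⟨C, hC.mono fun y hy v ↦ ?_⟩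
  refine (ContinuousLinearMap.le_opENorm
    (mfderiv 𝓘(ℝ, E) 𝓘(ℝ, E) (extChartAt 𝓘(ℝ, E) x).symm y) v).trans ?_
  gcongr
  · exact hy.le
  · rfl

end Charts

section Charts

variable {E : Type*} [NormedAddCommGroup E] [InnerProductSpace ℝ E]
  {M : Type*} [EMetricSpace M] [ChartedSpace E M]
  [RiemannianBundle (fun x : M ↦ TangentSpace 𝓘(ℝ, E) x)] [IsManifold 𝓘(ℝ, E) 1 M]
  [IsContinuousRiemannianBundle E (fun x : M ↦ TangentSpace 𝓘(ℝ, E) x)]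
  [IsRiemannianManifold 𝓘(ℝ, E) M]

/-- The charts of a Riemannian manifold are locally Lipschitz. -/
theorem exists_lipschitzOnWith_extChartAt (x : M) :
    ∃ K : ℝ≥0, ∃ s ∈ 𝓝 x, LipschitzOnWith K (extChartAt 𝓘(ℝ, E) x) s := by
  obtain ⟨C, hC⟩ := eventually_enorm_mfderiv_extChartAt_apply_le (E := E) x
  obtain ⟨s, hsC, hs, hxs⟩ := mem_nhds_iff.1 (inter_mem hC (chart_source_mem_nhds E x))
  obtain ⟨ε, hε, hεs⟩ := EMetric.mem_nhds_iff.1 (hs.mem_nhds hxs)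
  -- A path of length less than `2 * r` starting within `r` of `x` stays within `3 * r`, hence
  -- inside `s`.
  obtain ⟨r, hr, hrε⟩ : ∃ r : ℝ≥0∞, 0 < r ∧ 3 * r ≤ ε :=
    ⟨ε / 3, ENNReal.div_pos hε.ne' (by simp), by
      rw [ENNReal.mul_div_cancel (by simp) (by simp)]⟩
  refine ⟨C, Metric.eball x r, Metric.eball_mem_nhds x hr, fun y hy z hz ↦ ?_⟩
  have hyz : edist y z < 2 * r := by
    refine (edist_triangle_right y z x).trans_lt ?_
    rw [two_mul]
    exact ENNReal.add_lt_add hy hz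
  refine ENNReal.le_coe_mul_of_forall_gt hyz.ne_top fun L hL ↦ ?_
  -- The bound `L` gives the estimate, the bound `2 * r` keeps the path in `s`.
  have hL' : riemannianEDist 𝓘(ℝ, E) y z < min L (2 * r) := by
    rw [← IsRiemannianManifold.out (I := 𝓘(ℝ, E)) y z]
    exact lt_min hL hyz
  obtain ⟨η, h0, h1, hη, hlen⟩ := exists_lt_of_riemannianEDist_lt hL'
  have hηs : MapsTo η (Icc 0 1) s := by
    intro t ht
    refine hεs (Metric.mem_eball.2 ?_)
    have h2 : edist y (η t) < 2 * r := by
      rw [IsRiemannianManifold.out (I := 𝓘(ℝ, E)) y (η t)]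
      calc riemannianEDist 𝓘(ℝ, E) y (η t) ≤ pathELength 𝓘(ℝ, E) η 0 t :=
            riemannianEDist_le_pathELength (hη.mono (Icc_subset_Icc_right ht.2)) h0 rfl ht.1
        _ ≤ pathELength 𝓘(ℝ, E) η 0 1 := pathELength_mono le_rfl ht.2
        _ < 2 * r := hlen.trans_le (min_le_right _ _)
    calc edist (η t) x ≤ edist (η t) y + edist y x := edist_triangle _ _ _
      _ < 2 * r + r := by
        rw [edist_comm (η t)]
        exact ENNReal.add_lt_add h2 hy
      _ = 3 * r := by ring
      _ ≤ ε := hrε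
  have hf : ContMDiffOn 𝓘(ℝ, E) 𝓘(ℝ, E) 1 (extChartAt 𝓘(ℝ, E) x) s :=
    contMDiffOn_extChartAt.mono fun y hy ↦ (hsC hy).2
  have hp := pathELength_comp_le hs hf (C := C)
    (fun y hy v ↦ (enorm_tangentSpace_vectorSpace (F := E)).trans_le ((hsC hy).1 v)) hη hηs
  rw [IsRiemannianManifold.out (I := 𝓘(ℝ, E)) (extChartAt 𝓘(ℝ, E) x y)]
  calc riemannianEDist 𝓘(ℝ, E) (extChartAt 𝓘(ℝ, E) x y) (extChartAt 𝓘(ℝ, E) x z)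
      ≤ pathELength 𝓘(ℝ, E) (extChartAt 𝓘(ℝ, E) x ∘ η) 0 1 :=
        riemannianEDist_le_pathELength (hf.comp hη hηs) (by simp [h0]) (by simp [h1]) zero_le_one
    _ ≤ C * pathELength 𝓘(ℝ, E) η 0 1 := hp
    _ ≤ C * L := by
      gcongr
      exact (hlen.trans_le (min_le_left _ _)).le

/-- The inverses of the charts of a Riemannian manifold are locally Lipschitz. -/
theorem exists_lipschitzOnWith_extChartAt_symm (x : M) :
    ∃ K : ℝ≥0, ∃ s ∈ 𝓝 (extChartAt 𝓘(ℝ, E) x x),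
      LipschitzOnWith K (extChartAt 𝓘(ℝ, E) x).symm s := by
  obtain ⟨C, hC⟩ := eventually_enorm_mfderiv_extChartAt_symm_apply_le (E := E) x
  obtain ⟨r, hr, hrs⟩ := Metric.mem_nhds_iff.1 (inter_mem hC (extChartAt_target_mem_nhds x))
  refine ⟨C, Metric.ball _ r, Metric.ball_mem_nhds _ hr, fun y hy z hz ↦ ?_⟩
  have hf : ContMDiffOn 𝓘(ℝ, E) 𝓘(ℝ, E) 1 (extChartAt 𝓘(ℝ, E) x).symm (Metric.ball _ r) :=
    (contMDiffOn_extChartAt_symm x).mono fun y hy ↦ (hrs hy).2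
  let η := ContinuousAffineMap.lineMap (R := ℝ) y z
  have hη : ContMDiffOn 𝓘(ℝ, ℝ) 𝓘(ℝ, E) 1 η (Icc 0 1) := by
    rw [contMDiffOn_iff_contDiffOn]
    exact (ContinuousAffineMap.contDiff _).contDiffOn
  have hηs : MapsTo η (Icc 0 1) (Metric.ball (extChartAt 𝓘(ℝ, E) x x) r) := by
    refine mapsTo_iff_image_subset.2 ?_
    simp only [η, ContinuousAffineMap.coe_lineMap_eq, ← segment_eq_image_lineMap]
    exact (convex_ball _ _).segment_subset hy hz
  have hp := pathELength_comp_le Metric.isOpen_ball hf (C := C)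
    (fun y hy v ↦ ((hrs hy).1 v).trans_eq
      (congrArg _ (enorm_tangentSpace_vectorSpace (F := E)).symm)) hη hηs
  have hlen : pathELength 𝓘(ℝ, E) η 0 1 = edist y z := by
    rw [pathELength_eq_lintegral_mfderivWithin_Icc]
    simp only [mfderivWithin_eq_fderivWithin, enorm_tangentSpace_vectorSpace]
    exact lintegral_fderiv_lineMap_eq_edist
  rw [IsRiemannianManifold.out (I := 𝓘(ℝ, E)) ((extChartAt 𝓘(ℝ, E) x).symm y), ← hlen]
  refine le_trans ?_ hp
  exact riemannianEDist_le_pathELength (hf.comp hη hηs)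
    (by simp [η, ContinuousAffineMap.coe_lineMap_eq])
    (by simp [η, ContinuousAffineMap.coe_lineMap_eq]) zero_le_one

variable [MeasurableSpace M] [BorelSpace M] [FiniteDimensional ℝ E]

/-- The Hausdorff measure of the right dimension is locally finite on a Riemannian manifold. -/
theorem isLocallyFiniteMeasure_hausdorffMeasure :
    IsLocallyFiniteMeasure (μH[Module.finrank ℝ E] : Measure M) := by
  borelize E
  refine ⟨fun x ↦ ?_⟩
  obtain ⟨K, s, hs, hK⟩ := exists_lipschitzOnWith_extChartAt_symm (E := E) x
  obtain ⟨k, hks, hk⟩ : ∃ k ∈ 𝓝 (extChartAt 𝓘(ℝ, E) x x), k ⊆ s ∧ IsCompact k := by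
    obtain ⟨k, hk, hks, hkc⟩ := local_compact_nhds hs
    exact ⟨k, hk, hks, hkc⟩
  refine ⟨(extChartAt 𝓘(ℝ, E) x).symm '' k, ?_, ?_⟩
  · filter_upwards [extChartAt_source_mem_nhds (I := 𝓘(ℝ, E)) x,
      (continuousAt_extChartAt (I := 𝓘(ℝ, E)) x).preimage_mem_nhds hks] with y hy hyk
    exact ⟨_, hyk, (extChartAt 𝓘(ℝ, E) x).left_inv hy⟩
  · refine ((hK.mono hk.1).hausdorffMeasure_image_le (by positivity)).trans_lt ?_
    exact ENNReal.mul_lt_top (by simp) hk.2.measure_lt_top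

/-- The Hausdorff measure of the right dimension is positive on the nonempty open subsets of a
Riemannian manifold. -/
theorem isOpenPosMeasure_hausdorffMeasure :
    IsOpenPosMeasure (μH[Module.finrank ℝ E] : Measure M) := by
  borelize E
  refine ⟨fun O hO ⟨x, hx⟩ h0 ↦ ?_⟩
  obtain ⟨K, s, hs, hK⟩ := exists_lipschitzOnWith_extChartAt (E := E) x
  have hn : extChartAt 𝓘(ℝ, E) x '' (s ∩ O) ∈ 𝓝 (extChartAt 𝓘(ℝ, E) x x) :=
    extChartAt_image_nhds_mem_nhds_of_boundaryless (inter_mem hs (hO.mem_nhds hx))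
  have hle := (hK.mono inter_subset_left).hausdorffMeasure_image_le (s := s ∩ O)
    (d := Module.finrank ℝ E) (by positivity)
  rw [measure_mono_null inter_subset_right h0, mul_zero] at hle
  exact (measure_pos_of_mem_nhds _ hn).ne' (le_antisymm hle bot_le)

end Charts

end Manifold

end

/-! ### Discontinuous co-compact actions and covering estimates. -/

section

open MeasureTheory Measure
open scoped ENNReal NNReal

namespace WarpedPlane

/-- In a totally discontinuous action, the orbits meet a compact set a bounded number of times. -/
theorem TotallyDiscontinuous.exists_card_le {Γ X : Type*} [TopologicalSpace X] [Group Γ]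
    [MulAction Γ X] (h : TotallyDiscontinuous Γ X) {K : Set X} (hK : IsCompact K) :
    ∃ n : ℕ, ∀ (F : Finset Γ) (x : X), (∀ γ ∈ F, γ • x ∈ K) → F.card ≤ n := by
  classical
  refine hK.induction_on (p := fun K ↦ ∃ n : ℕ, ∀ (F : Finset Γ) (x : X),
    (∀ γ ∈ F, γ • x ∈ K) → F.card ≤ n) ?_ ?_ ?_ ?_
  · refine ⟨0, fun F x hF ↦ ?_⟩
    rw [Finset.eq_empty_of_forall_notMem (s := F) fun γ hγ ↦ hF γ hγ, Finset.card_empty]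
  · rintro s t hst ⟨n, hn⟩
    exact ⟨n, fun F x hF ↦ hn F x fun γ hγ ↦ hst (hF γ hγ)⟩
  · rintro s t ⟨n, hn⟩ ⟨m, hm⟩
    refine ⟨n + m, fun F x hF ↦ ?_⟩
    rw [← Finset.card_filter_add_card_filter_not (s := F) (fun γ ↦ γ • x ∈ s)]
    refine add_le_add (hn _ x ?_) (hm _ x ?_)
    · simp
    · intro γ hγ
      rw [Finset.mem_filter] at hγ
      exact (hF γ hγ.1).resolve_left hγ.2
  · intro x _
    obtain ⟨U, hU, hfin⟩ := h x
    refine ⟨U, mem_nhdsWithin_of_mem_nhds hU, hfin.toFinset.card, fun F y hF ↦ ?_⟩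
    rcases F.eq_empty_or_nonempty with rfl | ⟨γ₀, hγ₀⟩
    · simp
    -- `γ * γ₀⁻¹` sends `γ₀ • y ∈ U` to `γ • y ∈ U`, so it lies in the finite set attached to `U`.
    · refine Finset.card_le_card_of_injOn (fun γ ↦ γ * γ₀⁻¹) ?_ (by simp [InjOn])
      intro γ hγ
      simp only [Finite.coe_toFinset, mem_ofPred_eq]
      exact ⟨γ • y, ⟨γ₀ • y, hF _ hγ₀, by simp [mul_smul]⟩, hF _ hγ⟩

/-- A co-compact action by homeomorphisms of a locally compact space has a compact set whose
interior meets every orbit. -/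
theorem Cocompact.exists_isCompact {Γ X : Type*} [TopologicalSpace X] [LocallyCompactSpace X]
    [Group Γ] [MulAction Γ X] [ContinuousConstSMul Γ X] (h : Cocompact Γ X) :
    ∃ K : Set X, IsCompact K ∧ ∀ x : X, ∃ γ : Γ, γ • x ∈ interior K := by
  choose K hK hxK using fun x : X ↦ exists_compact_mem_nhds x
  have h' : CompactSpace (MulAction.orbitRel.Quotient Γ X) := h
  let mk : X → MulAction.orbitRel.Quotient Γ X := Quotient.mk _
  have hmk : IsOpenMap mk := isOpenMap_quotient_mk'_mul
  obtain ⟨T, hT⟩ := isCompact_univ.elim_finite_subcover (fun x ↦ mk '' interior (K x))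
    (fun x ↦ hmk _ isOpen_interior) (by
      intro q _
      induction q using Quotient.inductionOn with
      | h x => exact mem_iUnion.2 ⟨x, x, mem_interior_iff_mem_nhds.2 (hxK x), rfl⟩)
  refine ⟨⋃ x ∈ T, K x, T.isCompact_biUnion fun x _ ↦ hK x, fun y ↦ ?_⟩
  obtain ⟨x, hx, z, hz, hzy⟩ : ∃ x ∈ T, ∃ z ∈ interior (K x), mk z = mk y := by
    simpa using hT (mem_univ (mk y))
  obtain ⟨γ, hγ⟩ : ∃ γ : Γ, γ • y = z := MulAction.orbitRel_apply.1 (Quotient.exact hzy)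
  exact ⟨γ, hγ ▸ interior_mono (subset_biUnion_of_mem (u := K) hx) hz⟩

/-- A complete locally compact space with a contraction, all of whose iterates have continuous
left inverses, is second countable: it is exhausted by the preimages of a compact
neighbourhood of the fixed point. -/
theorem secondCountableTopology_of_contracting {N : Type*} [EMetricSpace N] [CompleteSpace N]
    [LocallyCompactSpace N] [Nonempty N] (hN : ∀ x y : N, edist x y ≠ ⊤) {K : ℝ≥0} {f g : N → N}
    (hf : ContractingWith K f) (hg : Continuous g) (hgf : Function.LeftInverse g f) :
    SecondCountableTopology N := by
  obtain ⟨x₀⟩ := ‹Nonempty N›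
  obtain ⟨y, hy, -, -⟩ := hf.exists_fixedPoint x₀ (hN _ _)
  obtain ⟨B, hB, hyB⟩ := exists_compact_mem_nhds y
  have hσ : SigmaCompactSpace N := by
    -- Iterates of `f` carry every point into `B` eventually, and `g^[n]` brings it back.
    refine ⟨⟨fun n ↦ g^[n] '' B, fun n ↦ hB.image (hg.iterate n), ?_⟩⟩
    refine eq_univ_of_forall fun x ↦ mem_iUnion.2 ?_
    obtain ⟨z, hz, hlim, -⟩ := hf.exists_fixedPoint x (hN _ _)
    have hzy : z = y := by
      rcases hf.eq_or_edist_eq_top_of_fixedPoints hz hy with h | h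
      · exact h
      · exact absurd h (hN _ _)
    rw [hzy] at hlim
    obtain ⟨n, hn⟩ := (hlim.eventually hyB).exists
    exact ⟨n, _, hn, hgf.iterate n x⟩
  exact EMetric.secondCountable_of_sigmaCompact N

/-- A similarity of ratio `K` multiplies the `d`-dimensional Hausdorff measure by `K ^ d`. -/
theorem map_hausdorffMeasure_of_similarity {N : Type*} [EMetricSpace N] [MeasurableSpace N]
    [BorelSpace N] {K : ℝ≥0} {f g : N → N} (hf : LipschitzWith K f)
    (hg : LipschitzWith K⁻¹ g) (hK : K ≠ 0) (hgf : Function.LeftInverse g f)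
    (hfg : Function.RightInverse g f) (d : ℕ) :
    Measure.map f (μH[d] : Measure N) = ((K⁻¹ : ℝ≥0) : ℝ≥0∞) ^ d • (μH[d] : Measure N) := by
  ext A hA
  rw [Measure.map_apply hf.continuous.measurable hA, Measure.smul_apply, smul_eq_mul]
  have h1 : f ⁻¹' A = g '' A := (image_eq_preimage_of_inverse hfg hgf).symm ▸ rfl
  apply le_antisymm
  · rw [h1]
    simpa using hg.hausdorffMeasure_image_le (d := d) (by positivity) A
  · have h2 : f '' (f ⁻¹' A) = A := image_preimage_eq A hfg.surjective
    have h3 := hf.hausdorffMeasure_image_le (d := d) (by positivity) (f ⁻¹' A)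
    rw [h2, ENNReal.rpow_natCast] at h3
    calc ((K⁻¹ : ℝ≥0) : ℝ≥0∞) ^ d * μH[d] A
        ≤ ((K⁻¹ : ℝ≥0) : ℝ≥0∞) ^ d * ((K : ℝ≥0∞) ^ d * μH[d] (f ⁻¹' A)) := by gcongr
      _ = μH[d] (f ⁻¹' A) := by
        rw [← mul_assoc, ← mul_pow, ← ENNReal.coe_mul, inv_mul_cancel₀ hK]
        simp

/-- If finitely many translates `γ V` cover a set of measure `m`, each `γ ∈ F` scaling the
measure by a factor at most `C` near `K`, and if orbits meet `K` at most `n` times, then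
`m ≤ C n μ(V)`. -/
theorem measure_le_of_subset_iUnion_smul {Γ X : Type*} [MeasurableSpace X] [Group Γ]
    [MulAction Γ X] {ν : Measure X} (hmeas : ∀ γ : Γ, Measurable fun x : X ↦ γ • x)
    {K V : Set X} (hK : MeasurableSet K) {n : ℕ}
    (hn : ∀ (F : Finset Γ) (x : X), (∀ γ ∈ F, γ • x ∈ K) → F.card ≤ n) {C : ℝ≥0∞}
    (hC : ∀ γ : Γ, ν (K ∩ (fun x ↦ γ⁻¹ • x) ⁻¹' V) ≤ C * ν ((fun x ↦ γ • x) ⁻¹' K ∩ V))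
    (F : Finset Γ) (hF : K ⊆ ⋃ γ ∈ F, (fun x ↦ γ⁻¹ • x) ⁻¹' V) :
    ν K ≤ C * n * ν V := by
  classical
  -- Each point lies in at most `n` of the sets `γ⁻¹ K`; integrate the sum of their indicators over
  -- `V`.
  have hsum : ∑ γ ∈ F, ν ((fun x ↦ γ • x) ⁻¹' K ∩ V) ≤ n * ν V := by
    calc ∑ γ ∈ F, ν ((fun x ↦ γ • x) ⁻¹' K ∩ V)
        = ∑ γ ∈ F, ∫⁻ x in V, ((fun x ↦ γ • x) ⁻¹' K).indicator 1 x ∂ν := by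
          refine Finset.sum_congr rfl fun γ _ ↦ ?_
          rw [lintegral_indicator_one (hmeas γ hK), Measure.restrict_apply (hmeas γ hK)]
      _ = ∫⁻ x in V, ∑ γ ∈ F, ((fun x ↦ γ • x) ⁻¹' K).indicator 1 x ∂ν :=
          (lintegral_finsetSum F fun γ _ ↦ measurable_one.indicator (hmeas γ hK)).symm
      _ ≤ ∫⁻ _ in V, n ∂ν := by
          refine lintegral_mono fun x ↦ ?_
          have h1 : ∑ γ ∈ F, ((fun x ↦ γ • x) ⁻¹' K).indicator (1 : X → ℝ≥0∞) x
              = ((F.filter fun γ ↦ γ • x ∈ K).card : ℝ≥0∞) := by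
            rw [Finset.card_filter]
            push_cast
            refine Finset.sum_congr rfl fun γ _ ↦ ?_
            simp [indicator_apply]
          rw [h1]
          exact Nat.cast_le.2 (hn _ x fun γ hγ ↦ (Finset.mem_filter.1 hγ).2)
      _ = n * ν V := by simp
  calc ν K ≤ ν (⋃ γ ∈ F, K ∩ (fun x ↦ γ⁻¹ • x) ⁻¹' V) := by
        refine measure_mono fun x hx ↦ ?_
        obtain ⟨γ, hγ, hxγ⟩ := mem_iUnion₂.1 (hF hx)
        exact mem_iUnion₂.2 ⟨γ, hγ, hx, hxγ⟩
    _ ≤ ∑ γ ∈ F, ν (K ∩ (fun x ↦ γ⁻¹ • x) ⁻¹' V) := measure_biUnion_finset_le _ _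
    _ ≤ ∑ γ ∈ F, C * ν ((fun x ↦ γ • x) ⁻¹' K ∩ V) := Finset.sum_le_sum fun γ _ ↦ hC γ
    _ = C * ∑ γ ∈ F, ν ((fun x ↦ γ • x) ⁻¹' K ∩ V) := by rw [Finset.mul_sum]
    _ ≤ C * (n * ν V) := by gcongr
    _ = C * n * ν V := by rw [mul_assoc]

/-! ### Actions by translations and similarities: the shifts vanish. -/

section Split

variable {N : Type*} [EMetricSpace N] {Γ : Type*} [Group Γ] [MulAction Γ (ℝ × ℝ × N)]

/-- Every `γ` acts on `ℝ × ℝ × N` by translations by `a γ` and `b γ` on the first two factors and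
by `φ γ` on the third; `b γ` shifts the values of `c` by the constant `ℓ γ`, and `φ γ` is
`e ^ (-ℓ γ)`-Lipschitz. -/
structure IsSplitAction (c : ℝ → ℝ) (a b ℓ : Γ → ℝ) (φ : Γ → N → N) : Prop where
  smul_eq : ∀ (γ : Γ) (p : ℝ × ℝ × N), γ • p = (p.1 + a γ, p.2.1 + b γ, φ γ p.2.2)
  add_eq : ∀ (γ : Γ) (t : ℝ), c (t + b γ) = c t + ℓ γ
  lipschitz : ∀ γ : Γ, LipschitzWith (Real.exp (-ℓ γ)).toNNReal (φ γ)

namespace IsSplitAction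

variable {c : ℝ → ℝ} {a b ℓ : Γ → ℝ} {φ : Γ → N → N}

theorem map_smul (h : IsSplitAction c a b ℓ φ) (γ : Γ) (p : ℝ × ℝ × N) :
    c (γ • p).2.1 = c p.2.1 + ℓ γ := by
  rw [h.smul_eq, h.add_eq]

variable [Nonempty N]

theorem shift_mul (h : IsSplitAction c a b ℓ φ) (γ γ' : Γ) : ℓ (γ * γ') = ℓ γ + ℓ γ' := by
  obtain ⟨x⟩ := ‹Nonempty N›
  have h1 := h.map_smul (γ * γ') (0, 0, x)
  rw [mul_smul, h.map_smul, h.map_smul] at h1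
  linarith

theorem shift_one (h : IsSplitAction c a b ℓ φ) : ℓ 1 = 0 := by
  have h1 := h.shift_mul 1 1
  rw [one_mul] at h1
  linarith

theorem shift_inv (h : IsSplitAction c a b ℓ φ) (γ : Γ) : ℓ γ⁻¹ = -ℓ γ := by
  have h1 := h.shift_mul γ⁻¹ γ
  rw [inv_mul_cancel, h.shift_one] at h1
  linarith

theorem shift_pow (h : IsSplitAction c a b ℓ φ) (γ : Γ) (n : ℕ) : ℓ (γ ^ n) = n * ℓ γ := by
  induction n with
  | zero => simp [h.shift_one]
  | succ n ih =>
    rw [pow_succ, h.shift_mul, ih]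
    push_cast
    ring

omit [Nonempty N] in
theorem leftInverse (h : IsSplitAction c a b ℓ φ) (γ : Γ) :
    Function.LeftInverse (φ γ⁻¹) (φ γ) := by
  intro x
  have h1 := inv_smul_smul γ ((0, 0, x) : ℝ × ℝ × N)
  rw [h.smul_eq, h.smul_eq] at h1
  exact congr($(h1).2.2)

omit [Nonempty N] in
theorem rightInverse (h : IsSplitAction c a b ℓ φ) (γ : Γ) :
    Function.RightInverse (φ γ⁻¹) (φ γ) := by
  intro x
  have h1 := smul_inv_smul γ ((0, 0, x) : ℝ × ℝ × N)
  rw [h.smul_eq, h.smul_eq] at h1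
  exact congr($(h1).2.2)

omit [Nonempty N] in
theorem continuousConstSMul (h : IsSplitAction c a b ℓ φ) :
    ContinuousConstSMul Γ (ℝ × ℝ × N) := by
  refine ⟨fun γ ↦ ?_⟩
  simp_rw [h.smul_eq]
  have := (h.lipschitz γ).continuous
  fun_prop

variable [MeasurableSpace N] [BorelSpace N] {d : ℕ}

/-- `φ γ` and its inverse `φ γ⁻¹` have reciprocal Lipschitz constants, so `φ γ` is an exact
similarity. -/
theorem map_hausdorffMeasure (h : IsSplitAction c a b ℓ φ) (γ : Γ) :
    Measure.map (φ γ) (μH[d] : Measure N)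
      = ENNReal.ofReal (Real.exp (d * ℓ γ)) • (μH[d] : Measure N) := by
  have hK : (Real.exp (-ℓ γ)).toNNReal ≠ 0 := by simp [Real.exp_pos]
  have hinv : (Real.exp (-ℓ γ⁻¹)).toNNReal = (Real.exp (-ℓ γ)).toNNReal⁻¹ := by
    rw [h.shift_inv, neg_neg, ← Real.toNNReal_inv, Real.exp_neg, inv_inv]
  have hg := h.lipschitz γ⁻¹
  rw [hinv] at hg
  rw [map_hausdorffMeasure_of_similarity (h.lipschitz γ) hg hK (h.leftInverse γ)
    (h.rightInverse γ) d, ← hinv, h.shift_inv, neg_neg, Real.exp_nat_mul,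
    ENNReal.ofReal_pow (Real.exp_pos _).le]
  rfl

variable [SecondCountableTopology N]

theorem map_prod (h : IsSplitAction c a b ℓ φ)
    (hfin : IsLocallyFiniteMeasure (μH[d] : Measure N)) (γ : Γ) :
    Measure.map (fun p : ℝ × ℝ × N ↦ γ • p)
        ((volume : Measure ℝ).prod ((volume : Measure ℝ).prod μH[d]))
      = ENNReal.ofReal (Real.exp (d * ℓ γ)) •
        ((volume : Measure ℝ).prod ((volume : Measure ℝ).prod μH[d])) := by
  have h1 : (fun p : ℝ × ℝ × N ↦ γ • p)
      = Prod.map (· + a γ) (Prod.map (· + b γ) (φ γ)) := funext fun p ↦ h.smul_eq γ p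
  have hφ : Measurable (φ γ) := (h.lipschitz γ).continuous.measurable
  rw [h1, ← Measure.map_prod_map _ _ (measurable_add_const _)
    ((measurable_add_const _).prodMap hφ), ← Measure.map_prod_map _ _ (measurable_add_const _) hφ,
    map_add_right_eq_self, map_add_right_eq_self, h.map_hausdorffMeasure,
    Measure.prod_smul_right, Measure.prod_smul_right]

/-- The shifts are bounded below, because the translations of the second factor commute with the
action and preserve the product measure, which `γ` scales by `e ^ (d ℓ γ)`. -/
theorem exists_le_shift [LocallyCompactSpace N] (h : IsSplitAction c a b ℓ φ) (hd : 1 ≤ d)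
    (hc : Continuous c) (hfin : IsLocallyFiniteMeasure (μH[d] : Measure N))
    (hpos : IsOpenPosMeasure (μH[d] : Measure N))
    (hdisc : TotallyDiscontinuous Γ (ℝ × ℝ × N)) (hcoc : Cocompact Γ (ℝ × ℝ × N)) :
    ∃ D : ℝ, ∀ σ : Γ, D ≤ ℓ σ := by
  have hcont := h.continuousConstSMul
  obtain ⟨K, hK, hKU⟩ := hcoc.exists_isCompact
  obtain ⟨n, hn⟩ := hdisc.exists_card_le hK
  obtain ⟨M, hM⟩ := hK.exists_bound_of_continuousOn
    (f := fun p : ℝ × ℝ × N ↦ c p.2.1) (by fun_prop)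
  simp only [Real.norm_eq_abs, abs_le] at hM
  let ν : Measure (ℝ × ℝ × N) := (volume : Measure ℝ).prod ((volume : Measure ℝ).prod μH[d])
  have hν : ∀ (γ : Γ) {A : Set (ℝ × ℝ × N)}, MeasurableSet A →
      ν ((fun p ↦ γ • p) ⁻¹' A) = ENNReal.ofReal (Real.exp (d * ℓ γ)) * ν A := by
    intro γ A hA
    rw [← Measure.map_apply (continuous_const_smul γ).measurable hA, h.map_prod hfin γ]
    rfl
  have hνU0 : ν (interior K) ≠ 0 := by
    obtain ⟨x⟩ := ‹Nonempty N›
    obtain ⟨γ, hγ⟩ := hKU (0, 0, x)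
    exact (isOpen_interior.measure_pos ν ⟨_, hγ⟩).ne'
  have hνU : ν (interior K) ≠ ⊤ :=
    ((measure_mono interior_subset).trans_lt hK.measure_lt_top).ne
  -- The solution for `ℓ σ` of `1 ≤ e^{d (2M + ℓ σ)} n`, which is `hone` below.
  refine ⟨-(2 * M) - Real.log n / d, fun σ ↦ ?_⟩
  -- Unlike `σ` itself, this translation commutes with all of `Γ` and preserves `ν`, while still
  -- shifting `c` by a constant.
  let Φ : ℝ × ℝ × N → ℝ × ℝ × N := Prod.map id (Prod.map (· + -b σ) id)
  have hΦ : Continuous Φ := by fun_prop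
  have hΦν : MeasurePreserving Φ ν ν :=
    (MeasurePreserving.id _).prod ((measurePreserving_add_right _ _).prod (MeasurePreserving.id _))
  have hcomm : ∀ (γ : Γ) (p : ℝ × ℝ × N), Φ (γ • p) = γ • Φ p := by
    intro γ p
    rw [h.smul_eq, h.smul_eq]
    simp [Φ, add_right_comm]
  have hΦc : ∀ p : ℝ × ℝ × N, c p.2.1 = c (Φ p).2.1 + ℓ σ := by
    intro p
    rw [← h.add_eq σ]
    simp [Φ]
  let V := Φ ⁻¹' interior K
  have hV : IsOpen V := isOpen_interior.preimage hΦ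
  have hνV : ν V = ν (interior K) :=
    hΦν.measure_preimage isOpen_interior.measurableSet.nullMeasurableSet
  obtain ⟨F, hF⟩ := hK.elim_finite_subcover (fun γ : Γ ↦ (fun p ↦ γ⁻¹ • p) ⁻¹' V)
    (fun γ ↦ hV.preimage (continuous_const_smul _)) (by
      intro p _
      obtain ⟨γ, hγ⟩ := hKU (Φ p)
      refine mem_iUnion.2 ⟨γ⁻¹, ?_⟩
      rw [← hcomm] at hγ
      simpa [V] using hγ)
  -- If `q ∈ K ∩ γ V`, then `c ≥ -M` at `q` and `c ≤ M + ℓ σ` at `γ⁻¹ q`. These values differ by `ℓ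
  -- γ`, so `ℓ γ ≥ -(2M + ℓ σ)`, which bounds the scaling factor `e^{-d ℓ γ}`.
  have hscale : ∀ γ : Γ, ν (K ∩ (fun p ↦ γ⁻¹ • p) ⁻¹' V)
      ≤ ENNReal.ofReal (Real.exp (d * (2 * M + ℓ σ))) * ν ((fun p ↦ γ • p) ⁻¹' K ∩ V) := by
    intro γ
    have hA : MeasurableSet (K ∩ (fun p : ℝ × ℝ × N ↦ γ⁻¹ • p) ⁻¹' V) :=
      hK.measurableSet.inter (hV.preimage (continuous_const_smul _)).measurableSet
    have hpre : (fun p ↦ γ • p) ⁻¹' (K ∩ (fun p : ℝ × ℝ × N ↦ γ⁻¹ • p) ⁻¹' V)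
        = (fun p ↦ γ • p) ⁻¹' K ∩ V := by
      ext p
      simp
    rw [← hpre, hν γ hA, ← mul_assoc, ← ENNReal.ofReal_mul (Real.exp_pos _).le, ← Real.exp_add]
    rcases eq_empty_or_nonempty (K ∩ (fun p : ℝ × ℝ × N ↦ γ⁻¹ • p) ⁻¹' V) with h0 | ⟨q, hqK, hqV⟩
    · simp [h0]
    · have h1 := (hM q hqK).1
      have h2 := (hM _ (interior_subset hqV)).2
      have h3 := hΦc (γ⁻¹ • q)
      rw [h.map_smul, h.shift_inv] at h3
      refine le_mul_of_one_le_left bot_le ?_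
      rw [ENNReal.one_le_ofReal, Real.one_le_exp_iff, ← mul_add]
      refine mul_nonneg (by positivity) ?_
      linarith
  have hmain := measure_le_of_subset_iUnion_smul (fun γ ↦ (continuous_const_smul γ).measurable)
    hK.measurableSet hn hscale F hF
  rw [hνV] at hmain
  -- Cancel `ν (interior K)`, finite and nonzero, using `ν (interior K) ≤ ν K`.
  have hone : (1 : ℝ≥0∞) ≤ ENNReal.ofReal (Real.exp (d * (2 * M + ℓ σ))) * n := by
    by_contra! hlt
    have := (ENNReal.mul_lt_mul_iff_left hνU0 hνU).2 hlt
    rw [one_mul] at this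
    exact (this.trans_le (measure_mono interior_subset)).not_ge hmain
  rw [← ENNReal.ofReal_natCast, ← ENNReal.ofReal_mul (Real.exp_pos _).le,
    ENNReal.one_le_ofReal] at hone
  have hn0 : (0 : ℝ) < n := by
    rcases Nat.eq_zero_or_pos n with rfl | hn0
    · norm_num at hone
    · exact_mod_cast hn0
  have hlog := Real.log_nonneg hone
  rw [Real.log_mul (Real.exp_pos _).ne' hn0.ne', Real.log_exp] at hlog
  have hd0 : (0 : ℝ) < d := by exact_mod_cast hd
  have hfinal : -Real.log n / d ≤ 2 * M + ℓ σ := by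
    rw [div_le_iff₀ hd0]
    linarith
  rw [neg_div] at hfinal
  linarith

-- A nonzero value of `ℓ` gives a `τ` with `ℓ τ > 0`, and `φ τ` is then a contraction. This supplies
-- the second countability needed for the product measure, and the powers of `τ⁻¹` violate the lower
-- bound on `ℓ`.
omit [SecondCountableTopology N] in
theorem shift_eq_zero [LocallyCompactSpace N] [CompleteSpace N] (hN : ∀ x y : N, edist x y ≠ ⊤)
    (h : IsSplitAction c a b ℓ φ) (hd : 1 ≤ d)
    (hc : Continuous c) (hfin : IsLocallyFiniteMeasure (μH[d] : Measure N))
    (hpos : IsOpenPosMeasure (μH[d] : Measure N))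
    (hdisc : TotallyDiscontinuous Γ (ℝ × ℝ × N)) (hcoc : Cocompact Γ (ℝ × ℝ × N)) (γ : Γ) :
    ℓ γ = 0 := by
  by_contra hne
  obtain ⟨τ, hτ⟩ : ∃ τ : Γ, 0 < ℓ τ := by
    rcases lt_or_gt_of_ne hne with hlt | hgt
    · exact ⟨γ⁻¹, by rw [h.shift_inv]; linarith⟩
    · exact ⟨γ, hgt⟩
  have hcontr : ContractingWith (Real.exp (-ℓ τ)).toNNReal (φ τ) :=
    ⟨by rw [Real.toNNReal_lt_one, Real.exp_lt_one_iff]; linarith, h.lipschitz τ⟩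
  have hsc : SecondCountableTopology N := secondCountableTopology_of_contracting hN hcontr
    (h.lipschitz τ⁻¹).continuous (h.leftInverse τ)
  obtain ⟨D, hD⟩ := h.exists_le_shift hd hc hfin hpos hdisc hcoc
  obtain ⟨n, hn⟩ := exists_nat_gt (-D / ℓ τ)
  have h1 := hD (τ⁻¹ ^ n)
  rw [h.shift_pow, h.shift_inv] at h1
  rw [div_lt_iff₀ hτ] at hn
  linarith

end IsSplitAction

end Split

end WarpedPlane

end

/-! ### From isometries preserving `∂_s` and `∂_t` to split actions. -/

section

open MeasureTheory Measure Manifold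
open scoped ENNReal NNReal

namespace WarpedPlane

section Slices

variable {d : ℕ} {N : Type*} [TopologicalSpace N] [ChartedSpace (EuclideanSpace ℝ (Fin d)) N]

theorem hasMFDerivAt_sliceS (s t : ℝ) (x : N) :
    HasMFDerivAt 𝓘(ℝ, ℝ) (model d) (fun u : ℝ ↦ (u, t, x)) s
      ((ContinuousLinearMap.id ℝ ℝ).prod (0 : ℝ →L[ℝ] ℝ × EuclideanSpace ℝ (Fin d))) :=
  (hasMFDerivAt_id s).prodMk (hasMFDerivAt_const (t, x) s)

theorem hasMFDerivAt_sliceT (s t : ℝ) (x : N) :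
    HasMFDerivAt 𝓘(ℝ, ℝ) (model d) (fun u : ℝ ↦ (s, u, x)) t
      ((0 : ℝ →L[ℝ] ℝ).prod ((ContinuousLinearMap.id ℝ ℝ).prod
        (0 : ℝ →L[ℝ] EuclideanSpace ℝ (Fin d)))) :=
  (hasMFDerivAt_const s t).prodMk ((hasMFDerivAt_id t).prodMk (hasMFDerivAt_const x t))

theorem hasMFDerivAt_sliceN (s t : ℝ) (x : N) :
    HasMFDerivAt (𝓡 d) (model d) (fun y : N ↦ (s, t, y)) x
      ((0 : EuclideanSpace ℝ (Fin d) →L[ℝ] ℝ).prod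
        ((0 : EuclideanSpace ℝ (Fin d) →L[ℝ] ℝ).prod (ContinuousLinearMap.id ℝ _))) :=
  (hasMFDerivAt_const s x).prodMk ((hasMFDerivAt_const t x).prodMk (hasMFDerivAt_id x))

end Slices

section Constancy

variable {E' : Type*} [NormedAddCommGroup E'] [NormedSpace ℝ E']
  {H' : Type*} [TopologicalSpace H'] {I' : ModelWithCorners ℝ E' H'}
  {M' : Type*} [EMetricSpace M'] [ChartedSpace H' M']
  [RiemannianBundle (fun x : M' ↦ TangentSpace I' x)] [IsRiemannianManifold I' M']

/-- A map between Riemannian manifolds with zero differential takes the same value at points at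
finite distance. -/
theorem eq_of_mfderiv_eq_zero {E : Type*} [NormedAddCommGroup E] [NormedSpace ℝ E]
    {H : Type*} [TopologicalSpace H] {I : ModelWithCorners ℝ E H}
    {M : Type*} [EMetricSpace M] [ChartedSpace H M]
    [RiemannianBundle (fun x : M ↦ TangentSpace I x)] [IsRiemannianManifold I M]
    {f : M → M'} (hf : ContMDiff I I' 1 f)
    (h0 : ∀ y, ∀ v : TangentSpace I y, mfderiv I I' f y v = 0) {x y : M} (hxy : edist x y ≠ ⊤) :
    f x = f y := by
  have h := edist_le_of_enorm_mfderiv_le (C := 0) hf (fun y v ↦ by simp [h0]) hxy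
  simpa using h

variable {d : ℕ} {N : Type*} [EMetricSpace N] [ChartedSpace (EuclideanSpace ℝ (Fin d)) N]
  {G : ℝ × ℝ × N → M'}

/-- Working along one factor at a time needs only the distances of `ℝ` and `N`, not that of the
warped product. -/
theorem eq_of_mfderiv_partialS (hG : ContMDiff (model d) I' 1 G)
    (h0 : ∀ p, mfderiv (model d) I' G p (partialS p) = 0) (s s' t : ℝ) (x : N) :
    G (s, t, x) = G (s', t, x) := by
  refine eq_of_mfderiv_eq_zero (I := 𝓘(ℝ, ℝ)) (I' := I') (f := fun u : ℝ ↦ G (u, t, x))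
    (hG.comp (contMDiff_id.prodMk contMDiff_const)) (fun u v ↦ ?_) (edist_ne_top s s')
  have h := ((hG.mdifferentiable one_ne_zero (u, t, x)).hasMFDerivAt).comp u
    (hasMFDerivAt_sliceS (d := d) u t x)
  have h1 : mfderiv 𝓘(ℝ, ℝ) I' (fun u : ℝ ↦ G (u, t, x)) u = _ := h.mfderiv
  have hv : ((ContinuousLinearMap.id ℝ ℝ).prod (0 : ℝ →L[ℝ] ℝ × EuclideanSpace ℝ (Fin d))) v
      = (show ℝ from v) • (partialS (d := d) (u, t, x)) := by
    refine Prod.ext ?_ (Prod.ext ?_ ?_)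
    · exact (mul_one (show ℝ from v)).symm
    · exact (mul_zero (show ℝ from v)).symm
    · exact (smul_zero (show ℝ from v)).symm
  rw [h1]
  refine (congrArg (mfderiv (model d) I' G (u, t, x)) hv).trans ?_
  rw [_root_.map_smul, h0]
  exact smul_zero _

theorem eq_of_mfderiv_partialT (hG : ContMDiff (model d) I' 1 G)
    (h0 : ∀ p, mfderiv (model d) I' G p (partialT p) = 0) (s t t' : ℝ) (x : N) :
    G (s, t, x) = G (s, t', x) := by
  refine eq_of_mfderiv_eq_zero (I := 𝓘(ℝ, ℝ)) (I' := I') (f := fun u : ℝ ↦ G (s, u, x))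
    (hG.comp (contMDiff_const.prodMk (contMDiff_id.prodMk contMDiff_const))) (fun u v ↦ ?_)
    (edist_ne_top t t')
  have h := ((hG.mdifferentiable one_ne_zero (s, u, x)).hasMFDerivAt).comp u
    (hasMFDerivAt_sliceT (d := d) s u x)
  have h1 : mfderiv 𝓘(ℝ, ℝ) I' (fun u : ℝ ↦ G (s, u, x)) u = _ := h.mfderiv
  have hv : ((0 : ℝ →L[ℝ] ℝ).prod ((ContinuousLinearMap.id ℝ ℝ).prod
        (0 : ℝ →L[ℝ] EuclideanSpace ℝ (Fin d)))) v
      = (show ℝ from v) • (partialT (d := d) (s, u, x)) := by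
    refine Prod.ext ?_ (Prod.ext ?_ ?_)
    · exact (mul_zero (show ℝ from v)).symm
    · exact (mul_one (show ℝ from v)).symm
    · exact (smul_zero (show ℝ from v)).symm
  rw [h1]
  refine (congrArg (mfderiv (model d) I' G (s, u, x)) hv).trans ?_
  rw [_root_.map_smul, h0]
  exact smul_zero _

/-- The vector `(0, 0, w)` tangent to `ℝ × ℝ × N`. -/
noncomputable def inclN (p : ℝ × ℝ × N) (w : EuclideanSpace ℝ (Fin d)) :
    TangentSpace (model d) p :=
  show ℝ × ℝ × EuclideanSpace ℝ (Fin d) from (0, 0, w)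

theorem eq_of_mfderiv_inclN [RiemannianBundle (fun x : N ↦ TangentSpace (𝓡 d) x)]
    [IsRiemannianManifold (𝓡 d) N] (hG : ContMDiff (model d) I' 1 G)
    (h0 : ∀ p w, mfderiv (model d) I' G p (inclN p w) = 0) (s t : ℝ) {x y : N}
    (hxy : edist x y ≠ ⊤) :
    G (s, t, x) = G (s, t, y) := by
  refine eq_of_mfderiv_eq_zero (I := 𝓡 d) (I' := I') (f := fun u : N ↦ G (s, t, u))
    (hG.comp (contMDiff_const.prodMk (contMDiff_const.prodMk contMDiff_id))) (fun u v ↦ ?_) hxy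
  have h := ((hG.mdifferentiable one_ne_zero (s, t, u)).hasMFDerivAt).comp u
    (hasMFDerivAt_sliceN (d := d) s t u)
  have h1 : mfderiv (𝓡 d) I' (fun u : N ↦ G (s, t, u)) u = _ := h.mfderiv
  rw [h1]
  exact h0 (s, t, u) v

end Constancy

section Isometries

variable {d : ℕ} {N : Type*} [EMetricSpace N] [ChartedSpace (EuclideanSpace ℝ (Fin d)) N]
  {Γ : Type*} [Group Γ] [MulAction Γ (ℝ × ℝ × N)]

theorem mfderiv_smul_fst {γ : Γ} {p : ℝ × ℝ × N}
    (h : MDifferentiableAt (model d) (model d) (fun q : ℝ × ℝ × N ↦ γ • q) p)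
    (v : TangentSpace (model d) p) :
    mfderiv (model d) 𝓘(ℝ, ℝ) (fun q : ℝ × ℝ × N ↦ (γ • q).1 - q.1) p v
      = ds (γ • p) (mfderiv (model d) (model d) (fun q : ℝ × ℝ × N ↦ γ • q) p v) - ds p v := by
  have h1 := (hasMFDerivAt_fst (I := 𝓘(ℝ, ℝ)) (I' := 𝓘(ℝ, ℝ).prod (𝓡 d)) (γ • p)).comp p
    h.hasMFDerivAt
  have h2 := h1.sub (hasMFDerivAt_fst (I := 𝓘(ℝ, ℝ)) (I' := 𝓘(ℝ, ℝ).prod (𝓡 d)) p)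
  exact congr($(h2.mfderiv) v)

theorem mfderiv_smul_snd_fst {γ : Γ} {p : ℝ × ℝ × N}
    (h : MDifferentiableAt (model d) (model d) (fun q : ℝ × ℝ × N ↦ γ • q) p)
    (v : TangentSpace (model d) p) :
    mfderiv (model d) 𝓘(ℝ, ℝ) (fun q : ℝ × ℝ × N ↦ (γ • q).2.1 - q.2.1) p v
      = dt (γ • p) (mfderiv (model d) (model d) (fun q : ℝ × ℝ × N ↦ γ • q) p v) - dt p v := by
  have h0 : ∀ p : ℝ × ℝ × N, HasMFDerivAt (model d) 𝓘(ℝ, ℝ) (fun q : ℝ × ℝ × N ↦ q.2.1) p _ :=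
    fun p ↦ (hasMFDerivAt_fst (I := 𝓘(ℝ, ℝ)) (I' := 𝓡 d) p.2).comp p
      (hasMFDerivAt_snd (I := 𝓘(ℝ, ℝ)) (I' := 𝓘(ℝ, ℝ).prod (𝓡 d)) p)
  have h2 := ((h0 (γ • p)).comp p h.hasMFDerivAt).sub (h0 p)
  exact congr($(h2.mfderiv) v)

theorem hasMFDerivAt_snd_snd (p : ℝ × ℝ × N) :
    HasMFDerivAt (model d) (𝓡 d) (fun q : ℝ × ℝ × N ↦ q.2.2) p
      ((ContinuousLinearMap.snd ℝ ℝ (EuclideanSpace ℝ (Fin d))).comp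
        (ContinuousLinearMap.snd ℝ ℝ (ℝ × EuclideanSpace ℝ (Fin d)))) :=
  (hasMFDerivAt_snd (I := 𝓘(ℝ, ℝ)) (I' := 𝓡 d) p.2).comp p
    (hasMFDerivAt_snd (I := 𝓘(ℝ, ℝ)) (I' := 𝓘(ℝ, ℝ).prod (𝓡 d)) p)

theorem mfderiv_smul_snd_snd {γ : Γ} {p : ℝ × ℝ × N}
    (h : MDifferentiableAt (model d) (model d) (fun q : ℝ × ℝ × N ↦ γ • q) p)
    (v : TangentSpace (model d) p) :
    mfderiv (model d) (𝓡 d) (fun q : ℝ × ℝ × N ↦ (γ • q).2.2) p v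
      = tangentN (γ • p) (mfderiv (model d) (model d) (fun q : ℝ × ℝ × N ↦ γ • q) p v) :=
  congr($(((hasMFDerivAt_snd_snd (γ • p)).comp p h.hasMFDerivAt).mfderiv) v)

theorem mfderiv_slice_smul_snd_snd {γ : Γ} {s t : ℝ} {x : N}
    (h : MDifferentiableAt (model d) (model d) (fun q : ℝ × ℝ × N ↦ γ • q) (s, t, x))
    (w : TangentSpace (𝓡 d) x) :
    mfderiv (𝓡 d) (𝓡 d) (fun y : N ↦ (γ • ((s, t, y) : ℝ × ℝ × N)).2.2) x w
      = tangentN (γ • (s, t, x)) (mfderiv (model d) (model d) (fun q : ℝ × ℝ × N ↦ γ • q)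
          (s, t, x) (inclN (s, t, x) w)) :=
  congr($((((hasMFDerivAt_snd_snd (γ • ((s, t, x) : ℝ × ℝ × N))).comp _ h.hasMFDerivAt).comp x
    (hasMFDerivAt_sliceN s t x)).mfderiv) w)

variable [RiemannianBundle (fun x : N ↦ TangentSpace (𝓡 d) x)] {c : ℝ → ℝ}

theorem metric_partialS (p : ℝ × ℝ × N) (v : TangentSpace (model d) p) :
    metric c p v (partialS p) = ds p v := by
  have h1 : ds p (partialS (d := d) p) = 1 := rfl
  have h2 : dt p (partialS (d := d) p) = 0 := rfl
  have h3 : tangentN p (partialS (d := d) p) = 0 := rfl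
  rw [metric, h1, h2, h3, inner_zero_right]
  ring

theorem metric_partialT (p : ℝ × ℝ × N) (v : TangentSpace (model d) p) :
    metric c p v (partialT p) = dt p v := by
  have h1 : ds p (partialT (d := d) p) = 0 := rfl
  have h2 : dt p (partialT (d := d) p) = 1 := rfl
  have h3 : tangentN p (partialT (d := d) p) = 0 := rfl
  rw [metric, h1, h2, h3, inner_zero_right]
  ring

/-- `ds` is the pairing with `∂_s`, and both the metric and `∂_s` are preserved. -/
theorem ds_mfderiv (hisom : ActsByIsometries d Γ N c)
    (hs : PreservesField (d := d) (N := N) Γ partialS) (γ : Γ) (p : ℝ × ℝ × N)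
    (v : TangentSpace (model d) p) :
    ds (γ • p) (mfderiv (model d) (model d) (fun q : ℝ × ℝ × N ↦ γ • q) p v) = ds p v := by
  have h := (hisom γ).2 p v (partialS p)
  rwa [hs γ p, metric_partialS, metric_partialS] at h

theorem dt_mfderiv (hisom : ActsByIsometries d Γ N c)
    (ht : PreservesField (d := d) (N := N) Γ partialT) (γ : Γ) (p : ℝ × ℝ × N)
    (v : TangentSpace (model d) p) :
    dt (γ • p) (mfderiv (model d) (model d) (fun q : ℝ × ℝ × N ↦ γ • q) p v) = dt p v := by
  have h := (hisom γ).2 p v (partialT p)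
  rwa [ht γ p, metric_partialT, metric_partialT] at h

/-- Since `ds` and `dt` are preserved, vectors tangent to `N` stay tangent to `N`; the factor is the
ratio of the warping functions at the two ends. -/
theorem norm_mfderiv_slice (hisom : ActsByIsometries d Γ N c)
    (hs : PreservesField (d := d) (N := N) Γ partialS)
    (ht : PreservesField (d := d) (N := N) Γ partialT) (γ : Γ) (s t : ℝ) (x : N)
    (w : TangentSpace (𝓡 d) x) :
    ‖mfderiv (𝓡 d) (𝓡 d) (fun y : N ↦ (γ • ((s, t, y) : ℝ × ℝ × N)).2.2) x w‖
      = Real.exp (c t - c (γ • ((s, t, x) : ℝ × ℝ × N)).2.1) * ‖w‖ := by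
  rw [mfderiv_slice_smul_snd_snd ((hisom γ).1.mdifferentiable (by simp) _)]
  have h := (hisom γ).2 (s, t, x) (inclN (s, t, x) w) (inclN (s, t, x) w)
  have h1 : ds (s, t, x) (inclN (s, t, x) w) = 0 := rfl
  have h2 : dt (s, t, x) (inclN (s, t, x) w) = 0 := rfl
  have h3 : tangentN (s, t, x) (inclN (s, t, x) w) = w := rfl
  rw [metric, metric, ds_mfderiv hisom hs, dt_mfderiv hisom ht, h1, h2, h3,
    real_inner_self_eq_norm_sq, real_inner_self_eq_norm_sq] at h
  simp only [mul_zero, zero_add] at h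
  rw [two_mul, two_mul, Real.exp_add, Real.exp_add] at h
  rw [Real.exp_sub, div_mul_eq_mul_div, eq_div_iff (Real.exp_pos _).ne', mul_comm,
    ← sq_eq_sq₀ (by positivity) (by positivity)]
  linarith

/-- A group of isometries of the warped product which preserves `∂_s` and `∂_t` acts by translations
on the factors `ℝ` and by similarities on `N`. -/
theorem exists_isSplitAction [IsRiemannianManifold (𝓡 d) N] [Nonempty N]
    (hN : ∀ x y : N, edist x y ≠ ⊤) (hd : 1 ≤ d) (hisom : ActsByIsometries d Γ N c)
    (hs : PreservesField (d := d) (N := N) Γ partialS)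
    (ht : PreservesField (d := d) (N := N) Γ partialT) :
    ∃ (a b ℓ : Γ → ℝ) (φ : Γ → N → N), IsSplitAction c a b ℓ φ := by
  obtain ⟨x₀⟩ := ‹Nonempty N›
  have hsmooth : ∀ γ : Γ, ContMDiff (model d) (model d) 1 (fun q : ℝ × ℝ × N ↦ γ • q) :=
    fun γ ↦ (hisom γ).1.of_le (by simp)
  have hdiff : ∀ (γ : Γ) (p : ℝ × ℝ × N),
      MDifferentiableAt (model d) (model d) (fun q : ℝ × ℝ × N ↦ γ • q) p :=
    fun γ ↦ (hsmooth γ).mdifferentiable one_ne_zero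
  have hfst : ∀ (γ : Γ) (s t : ℝ) (x : N), (γ • ((s, t, x) : ℝ × ℝ × N)).1
      = s + (γ • ((0, 0, x₀) : ℝ × ℝ × N)).1 := by
    intro γ s t x
    have hG : ContMDiff (model d) 𝓘(ℝ, ℝ) 1 (fun q : ℝ × ℝ × N ↦ (γ • q).1 - q.1) :=
      (contMDiff_fst.comp (hsmooth γ)).sub contMDiff_fst
    have h0 : ∀ p v, mfderiv (model d) 𝓘(ℝ, ℝ) (fun q : ℝ × ℝ × N ↦ (γ • q).1 - q.1) p v = 0 :=
      fun p v ↦ by rw [mfderiv_smul_fst (hdiff γ p), ds_mfderiv hisom hs, sub_self]; rfl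
    have h1 := eq_of_mfderiv_partialS hG (fun p ↦ h0 p _) s 0 t x
    have h2 := eq_of_mfderiv_partialT hG (fun p ↦ h0 p _) 0 t 0 x
    have h3 := eq_of_mfderiv_inclN hG (fun p w ↦ h0 p _) 0 0 (hN x x₀)
    have h4 := h1.trans (h2.trans h3)
    simp only at h4
    linarith
  have hsnd : ∀ (γ : Γ) (s t : ℝ) (x : N), (γ • ((s, t, x) : ℝ × ℝ × N)).2.1
      = t + (γ • ((0, 0, x₀) : ℝ × ℝ × N)).2.1 := by
    intro γ s t x
    have hG : ContMDiff (model d) 𝓘(ℝ, ℝ) 1 (fun q : ℝ × ℝ × N ↦ (γ • q).2.1 - q.2.1) :=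
      ((contMDiff_fst.comp contMDiff_snd).comp (hsmooth γ)).sub
        (contMDiff_fst.comp contMDiff_snd)
    have h0 : ∀ p v,
        mfderiv (model d) 𝓘(ℝ, ℝ) (fun q : ℝ × ℝ × N ↦ (γ • q).2.1 - q.2.1) p v = 0 :=
      fun p v ↦ by rw [mfderiv_smul_snd_fst (hdiff γ p), dt_mfderiv hisom ht, sub_self]; rfl
    have h1 := eq_of_mfderiv_partialS hG (fun p ↦ h0 p _) s 0 t x
    have h2 := eq_of_mfderiv_partialT hG (fun p ↦ h0 p _) 0 t 0 x
    have h3 := eq_of_mfderiv_inclN hG (fun p w ↦ h0 p _) 0 0 (hN x x₀)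
    have h4 := h1.trans (h2.trans h3)
    simp only at h4
    linarith
  have hφs : ∀ γ : Γ, ContMDiff (model d) (𝓡 d) 1 (fun q : ℝ × ℝ × N ↦ (γ • q).2.2) :=
    fun γ ↦ (contMDiff_snd.comp contMDiff_snd).comp (hsmooth γ)
  -- The differential sends `∂_s` and `∂_t` to themselves, and these have no component along `N`.
  have hthd : ∀ (γ : Γ) (s t : ℝ) (x : N), (γ • ((s, t, x) : ℝ × ℝ × N)).2.2
      = (γ • ((0, 0, x) : ℝ × ℝ × N)).2.2 := by
    intro γ s t x
    refine (eq_of_mfderiv_partialS (hφs γ) (fun p ↦ ?_) s 0 t x).trans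
      (eq_of_mfderiv_partialT (hφs γ) (fun p ↦ ?_) 0 t 0 x)
    · rw [mfderiv_smul_snd_snd (hdiff γ p), hs γ p]
      rfl
    · rw [mfderiv_smul_snd_snd (hdiff γ p), ht γ p]
      rfl
  have hnorm : ∀ (γ : Γ) (t : ℝ) (x : N) (w : TangentSpace (𝓡 d) x),
      ‖mfderiv (𝓡 d) (𝓡 d) (fun y : N ↦ (γ • ((0, 0, y) : ℝ × ℝ × N)).2.2) x w‖
        = Real.exp (c t - c (t + (γ • ((0, 0, x₀) : ℝ × ℝ × N)).2.1)) * ‖w‖ := by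
    intro γ t x w
    have h1 := norm_mfderiv_slice hisom hs ht γ 0 t x w
    rw [hsnd γ 0 t x] at h1
    have h2 : (fun y : N ↦ (γ • ((0, t, y) : ℝ × ℝ × N)).2.2)
        = fun y : N ↦ (γ • ((0, 0, y) : ℝ × ℝ × N)).2.2 := funext fun y ↦ hthd γ 0 t y
    -- The tangent space containing the value depends on the map, so the equality is substituted for
    -- general `f` and `g`.
    have h3 : ∀ f g : N → N, f = g → ‖mfderiv (𝓡 d) (𝓡 d) f x w‖ = ‖mfderiv (𝓡 d) (𝓡 d) g x w‖ := by
      rintro f _ rfl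
      rfl
    exact (h3 _ _ h2.symm).trans h1
  have : Nonempty (Fin d) := ⟨⟨0, hd⟩⟩
  obtain ⟨w, hw⟩ : ∃ w : TangentSpace (𝓡 d) x₀, w ≠ 0 :=
    exists_ne (0 : EuclideanSpace ℝ (Fin d))
  -- The left side of `hnorm` does not involve `t`; the nonzero vector `w`, available as `1 ≤ d`,
  -- lets the factors be compared.
  have hconst : ∀ (γ : Γ) (t : ℝ), c t - c (t + (γ • ((0, 0, x₀) : ℝ × ℝ × N)).2.1)
      = c 0 - c (0 + (γ • ((0, 0, x₀) : ℝ × ℝ × N)).2.1) := by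
    intro γ t
    have h1 := (hnorm γ t x₀ w).symm.trans (hnorm γ 0 x₀ w)
    exact Real.exp_injective (mul_right_cancel₀ (norm_ne_zero_iff.2 hw) h1)
  refine ⟨fun γ ↦ (γ • ((0, 0, x₀) : ℝ × ℝ × N)).1, fun γ ↦ (γ • ((0, 0, x₀) : ℝ × ℝ × N)).2.1,
    fun γ ↦ c (0 + (γ • ((0, 0, x₀) : ℝ × ℝ × N)).2.1) - c 0,
    fun γ x ↦ (γ • ((0, 0, x) : ℝ × ℝ × N)).2.2, ⟨fun γ p ↦ ?_, fun γ t ↦ ?_, fun γ x y ↦ ?_⟩⟩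
  · obtain ⟨s, t, x⟩ := p
    exact Prod.ext (hfst γ s t x) (Prod.ext (hsnd γ s t x) (hthd γ s t x))
  · linarith [hconst γ t]
  · refine edist_le_of_enorm_mfderiv_le (I := 𝓡 d) (I' := 𝓡 d)
      ((hφs γ).comp (contMDiff_const.prodMk (contMDiff_const.prodMk contMDiff_id)))
      (fun z v ↦ ?_) (hN x y)
    rw [← ofReal_norm, ← ofReal_norm, ← ENNReal.ofReal, ← ENNReal.ofReal_mul (Real.exp_pos _).le]
    refine ENNReal.ofReal_le_ofReal (le_of_eq ?_)
    rw [neg_sub]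
    exact hnorm γ 0 z v

end Isometries

end WarpedPlane

end

/-! ### Finite distances and the theorem. -/

/-- In a connected space, all points are at finite distance. -/
theorem edist_ne_top_of_preconnectedSpace {X : Type*} [PseudoEMetricSpace X] [PreconnectedSpace X]
    (x y : X) : edist x y ≠ ⊤ := by
  have h : IsClopen (Metric.eball y ⊤) := ⟨Metric.isClosed_eball_top, Metric.isOpen_eball⟩
  have h1 := h.eq_univ ⟨y, by simp⟩
  exact (Metric.mem_eball.1 (h1 ▸ mem_univ x)).ne

theorem lemma3p4 {d : ℕ} (hd : 1 ≤ d)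
    {N : Type*} [EMetricSpace N] [ChartedSpace (EuclideanSpace ℝ (Fin d)) N]
    [IsManifold (𝓡 d) ∞ N]
    [RiemannianBundle (fun x : N ↦ TangentSpace (𝓡 d) x)]
    [IsContMDiffRiemannianBundle (𝓡 d) ∞ (EuclideanSpace ℝ (Fin d))
      (fun x : N ↦ TangentSpace (𝓡 d) x)]
    [IsRiemannianManifold (𝓡 d) N]
    [CompleteSpace N] [SimplyConnectedSpace N]
    (c : ℝ → ℝ) (hc : ContDiff ℝ ∞ c)
    {Γ : Type*} [Group Γ] [MulAction Γ (ℝ × ℝ × N)]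
    (hisom : WarpedPlane.ActsByIsometries d Γ N c)
    (hdisc : WarpedPlane.TotallyDiscontinuous Γ (ℝ × ℝ × N))
    (hcocompact : WarpedPlane.Cocompact Γ (ℝ × ℝ × N))
    (hs : WarpedPlane.PreservesField (d := d) (N := N) Γ WarpedPlane.partialS)
    (ht : WarpedPlane.PreservesField (d := d) (N := N) Γ WarpedPlane.partialT)
    (γ : Γ) (s t : ℝ) (x : N) :
    c (γ • (s, t, x)).2.1 = c t := by
  borelize N
  have hcont : IsContinuousRiemannianBundle (EuclideanSpace ℝ (Fin d))
      (fun x : N ↦ TangentSpace (𝓡 d) x) := by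
    obtain ⟨g, hg, h⟩ := IsContMDiffRiemannianBundle.exists_contMDiff (IB := 𝓡 d) (n := ∞)
      (F := EuclideanSpace ℝ (Fin d)) (E := fun x : N ↦ TangentSpace (𝓡 d) x)
    exact ⟨g, hg.continuous, h⟩
  have hman : IsManifold (𝓡 d) 1 N := IsManifold.of_le (n := ∞) (by simp)
  have hloc : LocallyCompactSpace N := Manifold.locallyCompact_of_finiteDimensional (𝓡 d)
  have hne : Nonempty N := ⟨x⟩
  have hN : ∀ x y : N, edist x y ≠ ⊤ := edist_ne_top_of_preconnectedSpace
  have hfin := Manifold.isLocallyFiniteMeasure_hausdorffMeasure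
    (E := EuclideanSpace ℝ (Fin d)) (M := N)
  have hpos := Manifold.isOpenPosMeasure_hausdorffMeasure
    (E := EuclideanSpace ℝ (Fin d)) (M := N)
  rw [finrank_euclideanSpace_fin] at hfin hpos
  obtain ⟨a, b, ℓ, φ, h⟩ := WarpedPlane.exists_isSplitAction hN hd hisom hs ht
  rw [h.map_smul, h.shift_eq_zero hN hd hc.continuous hfin hpos hdisc hcocompact, add_zero]
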